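/- For a set $X$ and $\gamma>0$, and a set $F$ of functions from $X$ to $[0,1]$, let $\mathrm{fatV}_F(\gamma)\in\{0,1,2,\dots\}\cup\{\infty\}$ be the supremum of all $d$ for which there are $x_1,\dots,x_d\in X$ and a single $r\in[0,1]$ such that for every $b\in\{0,1\}^d$ some $f\in F$ satisfies, for all $i$, $f(x_i)\ge r+\gamma$ if $b_i=1$ and $f(x_i)\le r-\gamma$ if $b_i=0$. For countable $X$ and every integer $m\ge 1$, let $$\mathcal L(F,m)=\inf_A\ \sup_{D,\ f\in F}\ \int_{X^m}\bigl|A\bigl(((x_1,f(x_1)),\dots,(x_{m-1},f(x_{m-1}))),x_m\bigr)-f(x_m)\bigr|\,dD^m(x_1,\dots,x_m),$$ where $A$ ranges over all prediction strategies, that is, all maps from $\bigl(\bigcup_{n\ge 0}(X\times[0,1])^n\bigr)\times X$ to $[0,1]$, and $D$ ranges over all probability distributions on $X$. Let $\varepsilon>0$. (1) Let $X$ be a countable set and let $F$ be a set of functions from $X$ to $[0,1]$. If there is an $\alpha$ with $0<\alpha<\varepsilon$ and $\mathrm{fatV}_F(\varepsilon-\alpha)<\infty$, then $\mathcal L(F,m)<\varepsilon$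 for all sufficiently large $m$. (2) Conversely, if $\varepsilon\le 1/2$, there is a set $F$ of functions from $\mathbb N$ to $[0,1]$ such that $\mathrm{fatV}_F(\varepsilon)=\infty$ and $\mathrm{fatV}_F(\varepsilon+\alpha)=0$ for all $\alpha>0$, but $\mathcal L(F,m)\ge\varepsilon$ for all $m\ge 1$. -/

import Mathlib

open scoped ENNReal unitInterval

/-- The map `ψ_{r,γ}` from `[0,1]` to `{0, ⋆, 1}` (for `γ > 0`). The values `1`, `0` and the
"don't care" value `⋆` are encoded as `some true`, `some false` and `none`. -/
noncomputable def psi (r : I) (γ : ℝ) (y : I) : Option Bool :=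
  if (r : ℝ) + γ ≤ y then some true
  else if (y : ℝ) ≤ r - γ then some false
  else none

/-- The sequence `x₁, …, x_d` is `γ`-fatly Vapnik-shattered by `F`: for a single threshold
`r ∈ [0,1]`, every pattern in `{0,1}^d` has the form `(ψ_{r,γ}(f(x₁)), …, ψ_{r,γ}(f(x_d)))`
for some `f ∈ F`. -/
def FatlyVShattered {X : Type*} (F : Set (X → I)) (γ : ℝ) {d : ℕ} (x : Fin d → X) : Prop :=
  ∃ r : I, ∀ b : Fin d → Bool, ∃ f ∈ F, ∀ i, psi r γ (f (x i)) = some (b i)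

/-- `fatV_F(γ)`, for `γ > 0`: the length of the longest sequence that is `γ`-fatly
Vapnik-shattered by `F`; it is `⊤` if such sequences are arbitrarily long. -/
noncomputable def fatV {X : Type*} (F : Set (X → I)) (γ : ℝ) : ℕ∞ :=
  ⨆ d ∈ {d : ℕ | ∃ x : Fin d → X, FatlyVShattered F γ x}, (d : ℕ∞)

/-- A prediction strategy: a mapping from `(⋃_m (X × [0,1])^m) × X` to `[0,1]`. -/
abbrev PredictionStrategy (X : Type*) := List (X × I) × X → I

/-- The expected absolute error of the strategy `A` on the `m`-th of `m` points drawn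
independently from `D`, when it is given the first `m - 1` points labelled by `f` and the `m`-th
point unlabelled. Here `m.natPred + 1 = m`. -/
noncomputable def expectedError {X : Type*} [MeasurableSpace X] (A : PredictionStrategy X)
    (D : MeasureTheory.ProbabilityMeasure X) (f : X → I) (m : ℕ+) : ℝ≥0∞ :=
  ∫⁻ x : Fin (m.natPred + 1) → X,
    ENNReal.ofReal
      |(A (List.ofFn fun i : Fin m.natPred => (x i.castSucc, f (x i.castSucc)),
          x (Fin.last m.natPred)) : ℝ) - f (x (Fin.last m.natPred))|
    ∂MeasureTheory.Measure.pi fun _ => (D : MeasureTheory.Measure X)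

/-- `L(F,m)`: the worst-case expected error, over all probability distributions `D` on `X` and all
targets `f ∈ F`, of the best prediction strategy. -/
noncomputable def minimaxError {X : Type*} [MeasurableSpace X] (F : Set (X → I)) (m : ℕ+) :
    ℝ≥0∞ :=
  ⨅ A : PredictionStrategy X, ⨆ D : MeasureTheory.ProbabilityMeasure X, ⨆ f ∈ F,
    expectedError A D f m

/-! Upper bound. At one threshold `r`, the maps `psi r γ ∘ f` are partial concepts, and `fatV F γ ≤
d` bounds by `d` the VC dimension of the total concepts they induce on any finite set. The
one-inclusion graph of such a family, and of each subfamily, has at most `d` edges per vertex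
(`sum_card_edgesAlong_le`), so Hall's theorem orients it with out-degrees at most `d`. This yields a
rule with at most `d` leave-one-out mistakes on every sample (`exists_threshold_predictor`); by
exchangeability it errs on the last of `m` points with probability at most `d / m`. The fraction of
thresholds `k / n` voting 1 estimates `f x` up to `γ + 1 / n` plus the fraction of mistaken
thresholds (`abs_proportion_sub_le`). The expected error is thus at most `γ + 1 / n + d / m`, which
is below `ε` for `γ = ε - α` and large `n`, `m`.

Lower bound. Take all functions into `{1/2 - ε, 1/2 + ε}` and a uniform distribution on many points.
The test point is then new with probability close to 1, the sample says nothing about its label, and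
any guess has average error at least `ε` over the two possible values. -/

/-! ### One-inclusion graphs: edge density and orientation. -/

section OneInclusion

variable {α : Type*} [DecidableEq α]

/-- The lower endpoints of the edges in direction `x` of the one-inclusion graph of `V`. -/
def edgesAlong (V : Finset (Finset α)) (x : α) : Finset (Finset α) :=
  V.filter fun A => x ∉ A ∧ insert x A ∈ V

lemma mem_edgesAlong {V : Finset (Finset α)} {x : α} {A : Finset α} :
    A ∈ edgesAlong V x ↔ A ∈ V ∧ x ∉ A ∧ insert x A ∈ V := by
  simp [edgesAlong]

lemma edgesAlong_mono {V W : Finset (Finset α)} (h : V ⊆ W) (x : α) :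
    edgesAlong V x ⊆ edgesAlong W x := by
  intro A hA
  rw [mem_edgesAlong] at hA ⊢
  exact ⟨h hA.1, hA.2.1, h hA.2.2⟩

lemma edgesAlong_self (V : Finset (Finset α)) (a : α) :
    edgesAlong V a = V.nonMemberSubfamily a ∩ V.memberSubfamily a := by
  ext A
  simp only [mem_edgesAlong, Finset.mem_inter, Finset.mem_nonMemberSubfamily,
    Finset.mem_memberSubfamily]
  tauto

lemma card_edgesAlong_of_ne (V : Finset (Finset α)) {a x : α} (h : x ≠ a) :
    (edgesAlong V x).card =
      (edgesAlong (V.memberSubfamily a) x).card +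
        (edgesAlong (V.nonMemberSubfamily a) x).card := by
  rw [← Finset.card_memberSubfamily_add_card_nonMemberSubfamily a (edgesAlong V x)]
  congr 2
  · ext A
    simp only [mem_edgesAlong, Finset.mem_memberSubfamily, Finset.mem_insert, Finset.insert_comm x a]
    have := h.symm
    tauto
  · ext A
    simp only [mem_edgesAlong, Finset.mem_nonMemberSubfamily, Finset.mem_insert]
    have := h.symm
    tauto

/-- Supermodularity of the edge count: an edge common to both graphs survives in the intersection,
and the union may gain edges between the two families. -/
lemma card_edgesAlong_add_le (V W : Finset (Finset α)) (x : α) :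
    (edgesAlong V x).card + (edgesAlong W x).card ≤
      (edgesAlong (V ∪ W) x).card + (edgesAlong (V ∩ W) x).card := by
  rw [← Finset.card_union_add_card_inter]
  refine Nat.add_le_add (Finset.card_le_card ?_) (Finset.card_le_card ?_)
  · exact Finset.union_subset (edgesAlong_mono Finset.subset_union_left x)
      (edgesAlong_mono Finset.subset_union_right x)
  · intro A
    simp only [mem_edgesAlong, Finset.mem_inter]
    tauto

lemma shatters_of_union_subfamilies {V : Finset (Finset α)} {a : α} {S : Finset α}
    (h : (V.nonMemberSubfamily a ∪ V.memberSubfamily a).Shatters S) : V.Shatters S := by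
  have haS : a ∉ S := by
    intro ha
    obtain ⟨u, hu, hSu⟩ := h (Finset.Subset.refl S)
    have : a ∈ u := Finset.inter_subset_right (hSu.symm ▸ ha)
    simp only [Finset.mem_union, Finset.mem_nonMemberSubfamily, Finset.mem_memberSubfamily] at hu
    tauto
  intro t ht
  obtain ⟨u, hu, hSu⟩ := h ht
  rcases Finset.mem_union.1 hu with hu | hu
  · exact ⟨u, (Finset.mem_nonMemberSubfamily.1 hu).1, hSu⟩
  · exact ⟨insert a u, (Finset.mem_memberSubfamily.1 hu).1, by
      rwa [Finset.inter_insert_of_notMem haS]⟩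

/-- Each member of the intersection lies in `V` both with and without `a`, so `a` can be shattered
for free. This is what lowers the dimension by one in the edge count. -/
lemma shatters_insert_of_inter_subfamilies {V : Finset (Finset α)} {a : α} {S : Finset α}
    (h : (V.nonMemberSubfamily a ∩ V.memberSubfamily a).Shatters S) :
    a ∉ S ∧ V.Shatters (insert a S) := by
  have haS : a ∉ S := by
    intro ha
    obtain ⟨u, hu, hSu⟩ := h (Finset.Subset.refl S)
    have : a ∈ u := Finset.inter_subset_right (hSu.symm ▸ ha)
    simp only [Finset.mem_inter, Finset.mem_nonMemberSubfamily] at hu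
    tauto
  refine ⟨haS, fun t ht => ?_⟩
  obtain ⟨u, hu, hSu⟩ := h (t := t.erase a) (by
    intro y hy
    have := ht (Finset.mem_of_mem_erase hy)
    exact (Finset.mem_insert.1 this).resolve_left (Finset.ne_of_mem_erase hy))
  simp only [Finset.mem_inter, Finset.mem_nonMemberSubfamily, Finset.mem_memberSubfamily] at hu
  by_cases hat : a ∈ t
  · refine ⟨insert a u, hu.2.1, ?_⟩
    rw [← Finset.insert_inter_distrib, hSu, Finset.insert_erase hat]
  · refine ⟨u, hu.1.1, ?_⟩
    rw [Finset.insert_inter_of_notMem hu.1.2, hSu, Finset.erase_eq_of_notMem hat]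

/-- The one-inclusion graph of a family of Vapnik–Chervonenkis dimension at most `d` has at most
`d` times as many edges as vertices. -/
theorem sum_card_edgesAlong_le (T : Finset α) : ∀ (d : ℕ) (V : Finset (Finset α)),
    V ⊆ T.powerset → (∀ S, V.Shatters S → S.card ≤ d) →
      ∑ x ∈ T, (edgesAlong V x).card ≤ d * V.card := by
  induction T using Finset.induction_on with
  | empty => intro d V _ _; simp
  | insert a T ha ih =>
    intro d V hV hd
    set V₀ := V.nonMemberSubfamily a with hV₀
    set V₁ := V.memberSubfamily a with hV₁
    have h₀ : V₀ ⊆ T.powerset := by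
      intro A hA
      have hA' := Finset.mem_nonMemberSubfamily.1 hA
      exact Finset.mem_powerset.2 ((Finset.subset_insert_iff_of_notMem hA'.2).1
        (Finset.mem_powerset.1 (hV hA'.1)))
    have h₁ : V₁ ⊆ T.powerset := by
      intro A hA
      have hA' := Finset.mem_memberSubfamily.1 hA
      exact Finset.mem_powerset.2 ((Finset.insert_subset_insert_iff hA'.2).1
        (Finset.mem_powerset.1 (hV hA'.1)))
    have hcard : V.card = (V₀ ∪ V₁).card + (V₀ ∩ V₁).card := by
      rw [Finset.card_union_add_card_inter, add_comm,
        Finset.card_memberSubfamily_add_card_nonMemberSubfamily]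
    have hU : ∑ x ∈ T, (edgesAlong (V₀ ∪ V₁) x).card ≤ d * (V₀ ∪ V₁).card :=
      ih d _ (Finset.union_subset h₀ h₁) fun S hS => hd S (shatters_of_union_subfamilies hS)
    -- The extra summand counts the edges in direction `a`. It is paid for by the intersection
    -- having dimension at most `d - 1`.
    have hI : ∑ x ∈ T, (edgesAlong (V₀ ∩ V₁) x).card + (V₀ ∩ V₁).card ≤ d * (V₀ ∩ V₁).card := by
      rcases (V₀ ∩ V₁).eq_empty_or_nonempty with he | ⟨A, hA⟩
      · simp [he, edgesAlong]
      · have hpos : 0 < d := by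
          have hsh : (V₀ ∩ V₁).Shatters ∅ := by
            intro t ht
            exact ⟨A, hA, by rw [Finset.subset_empty.1 ht, Finset.empty_inter]⟩
          have := hd _ (shatters_insert_of_inter_subfamilies hsh).2
          simp at this
          omega
        obtain ⟨e, rfl⟩ : ∃ e, d = e + 1 := ⟨d - 1, by omega⟩
        have := ih e (V₀ ∩ V₁) (Finset.inter_subset_left.trans h₀) fun S hS => by
          obtain ⟨hn, hs⟩ := shatters_insert_of_inter_subfamilies hS
          have := hd _ hs
          rw [Finset.card_insert_of_notMem hn] at this
          omega
        rw [add_mul, one_mul]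
        omega
    have hsplit : ∑ x ∈ T, (edgesAlong V x).card ≤
        ∑ x ∈ T, (edgesAlong (V₀ ∪ V₁) x).card + ∑ x ∈ T, (edgesAlong (V₀ ∩ V₁) x).card := by
      rw [← Finset.sum_add_distrib]
      refine Finset.sum_le_sum fun x hx => ?_
      have hxa : x ≠ a := fun h => ha (h ▸ hx)
      rw [card_edgesAlong_of_ne V hxa, add_comm]
      exact card_edgesAlong_add_le _ _ _
    rw [Finset.sum_insert ha, edgesAlong_self, ← hV₀, ← hV₁, hcard, mul_add]
    omega

/-- The one-inclusion graph of a family of dimension at most `d` has an orientation in which every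
out-degree is at most `d`. Stated as a prediction rule: `pred B x` predicts whether `x` belongs to
an unknown member `A` of the family, given `B = A \ {x}`. -/
theorem exists_oneInclusion_predictor (T : Finset α) (d : ℕ) (V : Finset (Finset α))
    (hV : V ⊆ T.powerset) (hd : ∀ S, V.Shatters S → S.card ≤ d) :
    ∃ pred : Finset α → α → Prop, ∀ A ∈ V, ∀ M ⊆ T,
      (∀ x ∈ M, ¬ (pred (A.erase x) x ↔ x ∈ A)) → M.card ≤ d := by
  classical
  let E : Finset (Σ _ : α, Finset α) := T.sigma (edgesAlong V)
  -- Every vertex owns `d` slots, and an edge may take any slot of either endpoint. An injective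
  -- choice is an orientation with out-degrees at most `d`.
  let t : E → Finset (Finset α × Fin d) := fun e =>
    {e.1.2, insert e.1.1 e.1.2} ×ˢ Finset.univ
  have hall : ∀ s : Finset E, s.card ≤ (s.biUnion t).card := by
    intro s
    let W : Finset (Finset α) := s.biUnion fun e => {e.1.2, insert e.1.1 e.1.2}
    have hWV : W ⊆ V := by
      intro A hA
      obtain ⟨e, -, he⟩ := Finset.mem_biUnion.1 hA
      have hE := mem_edgesAlong.1 (Finset.mem_sigma.1 e.2).2
      simp only [Finset.mem_insert, Finset.mem_singleton] at he
      rcases he with rfl | rfl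
      · exact hE.1
      · exact hE.2.2
    have hbi : s.biUnion t = W ×ˢ Finset.univ := by
      ext ⟨A, k⟩
      simp [t, W]
    have hs : s.card ≤ (T.sigma (edgesAlong W)).card := by
      rw [← Finset.card_map (Function.Embedding.subtype _)]
      refine Finset.card_le_card fun e he => ?_
      obtain ⟨e', he', rfl⟩ := Finset.mem_map.1 he
      have hE := Finset.mem_sigma.1 e'.2
      refine Finset.mem_sigma.2 ⟨hE.1, mem_edgesAlong.2 ⟨?_, (mem_edgesAlong.1 hE.2).2.1, ?_⟩⟩
      · exact Finset.mem_biUnion.2 ⟨e', he', by simp⟩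
      · exact Finset.mem_biUnion.2 ⟨e', he', by simp⟩
    have := sum_card_edgesAlong_le T d W (hWV.trans hV) fun S hS => hd S (hS.mono_left hWV)
    rw [hbi, Finset.card_product, Finset.card_univ, Fintype.card_fin, mul_comm]
    rw [Finset.card_sigma] at hs
    exact hs.trans this
  obtain ⟨g, hginj, hg⟩ := (Finset.all_card_le_biUnion_card_iff_exists_injective t).1 hall
  -- When both completions of `B` lie in `V`, predict the endpoint that did not receive the edge. A
  -- mistake on `A` then means that the edge took a slot of `A`.
  refine ⟨fun B x => insert x B ∈ V ∧ ∀ h : (⟨x, B⟩ : Σ _ : α, Finset α) ∈ E, (g ⟨_, h⟩).1 = B,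
    fun A hA M hMT hM => ?_⟩
  have key : ∀ x ∈ M, ∃ h : (⟨x, A.erase x⟩ : Σ _ : α, Finset α) ∈ E, (g ⟨_, h⟩).1 = A := by
    intro x hx
    have hmis := hM x hx
    by_cases hxA : x ∈ A
    · simp only [hxA, iff_true, Finset.insert_erase hxA, hA, true_and, not_forall] at hmis
      obtain ⟨h, hne⟩ := hmis
      refine ⟨h, ?_⟩
      have := hg ⟨_, h⟩
      simp only [t, Finset.mem_product, Finset.mem_insert, Finset.mem_singleton,
        Finset.insert_erase hxA] at this
      exact this.1.resolve_left hne
    · simp only [hxA, iff_false, not_not, Finset.erase_eq_of_notMem hxA] at hmis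
      have h : (⟨x, A⟩ : Σ _ : α, Finset α) ∈ E :=
        Finset.mem_sigma.2 ⟨hMT hx, mem_edgesAlong.2 ⟨hA, hxA, hmis.1⟩⟩
      rw [Finset.erase_eq_of_notMem hxA]
      exact ⟨h, hmis.2 h⟩
  choose h₁ h₂ using key
  have : M.attach.card ≤ (Finset.univ : Finset (Fin d)).card := by
    refine Finset.card_le_card_of_injOn (fun x => (g ⟨_, h₁ x.1 x.2⟩).2) (by simp) ?_
    intro x _ y _ hxy
    have := hginj (Prod.ext ((h₂ x.1 x.2).trans (h₂ y.1 y.2).symm) hxy)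
    simp only [Subtype.mk.injEq, Sigma.mk.injEq] at this
    exact Subtype.ext this.1
  simpa using this

end OneInclusion

/-! ### Leave-one-out prediction of the partial concepts at one threshold. -/

section PartialConcepts

variable {X : Type*}

lemma psi_eq_some_true_iff {r y : I} {γ : ℝ} : psi r γ y = some true ↔ (r : ℝ) + γ ≤ y := by
  unfold psi
  split_ifs <;> simp_all

lemma psi_eq_some_false_iff {r y : I} {γ : ℝ} (hγ : 0 < γ) :
    psi r γ y = some false ↔ (y : ℝ) ≤ r - γ := by
  unfold psi
  split_ifs with h₁ h₂
  · simp only [Option.some.injEq, Bool.true_eq_false, false_iff, not_le]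
    linarith
  · simpa using h₂
  · simpa using h₂

/-- The positive parts of the total concepts on `T` induced by the partial concepts
`psi r γ ∘ f`, `f ∈ F`. -/
noncomputable def totalConcepts [DecidableEq X] (F : Set (X → I)) (r : I) (γ : ℝ)
    (T : Finset X) : Finset (Finset X) :=
  open Classical in
  T.powerset.filter fun A => ∃ f ∈ F, ∀ x ∈ T, psi r γ (f x) = some (decide (x ∈ A))

/-- Members of `totalConcepts` come from functions with no "don't care" value on `T`, so an
enumeration of a shattered set is fatly V-shattered with the same `r`. -/
lemma card_le_of_totalConcepts_shatters [DecidableEq X] {F : Set (X → I)} {r : I} {γ : ℝ}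
    {T : Finset X} {d : ℕ} (hd : fatV F γ ≤ d) {S : Finset X}
    (hS : (totalConcepts F r γ T).Shatters S) : S.card ≤ d := by
  classical
  have hST : S ⊆ T := by
    obtain ⟨u, hu, hSu⟩ := hS (Finset.Subset.refl S)
    exact (Finset.inter_eq_left.1 hSu).trans
      (Finset.mem_powerset.1 (Finset.mem_filter.1 hu).1)
  have hsh : FatlyVShattered F γ (fun i => (S.equivFin.symm i : X)) := by
    refine ⟨r, fun b => ?_⟩
    obtain ⟨u, hu, hSu⟩ := hS (t := S.filter fun x => ∃ h : x ∈ S, b (S.equivFin ⟨x, h⟩) = true)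
      (Finset.filter_subset _ _)
    obtain ⟨f, hf, hfT⟩ := (Finset.mem_filter.1 hu).2
    refine ⟨f, hf, fun i => ?_⟩
    have hi := (S.equivFin.symm i).2
    rw [hfT _ (hST hi)]
    have : (S.equivFin.symm i : X) ∈ u ↔ b i = true := by
      have h := Finset.ext_iff.1 hSu (S.equivFin.symm i : X)
      simpa using h
    congr 1
    rw [Bool.eq_iff_iff, decide_eq_true_iff, this]
  have : (S.card : ℕ∞) ≤ fatV F γ :=
    le_iSup₂ (f := fun (d : ℕ) (_ : d ∈ {d : ℕ | ∃ x : Fin d → X, FatlyVShattered F γ x}) =>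
      (d : ℕ∞)) S.card ⟨_, hsh⟩
  exact_mod_cast this.trans hd

/-- The points of a labelled sample that `psi r γ` does not send to "don't care". -/
noncomputable def decidedPoints (r : I) (γ : ℝ) (S : Set (X × I)) : Set X :=
  {x | ∃ y, (x, y) ∈ S ∧ psi r γ y ≠ none}

/-- The points of a labelled sample that `psi r γ` labels `1`. -/
noncomputable def positivePoints (r : I) (γ : ℝ) (S : Set (X × I)) : Set X :=
  {x | ∃ y, (x, y) ∈ S ∧ psi r γ y = some true}

/-- The graph of `f` on the points of `x` other than the `i`-th. -/
def leaveOneOut {n : ℕ} (f : X → I) (x : Fin n → X) (i : Fin n) : Set (X × I) :=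
  {p | ∃ j, j ≠ i ∧ p = (x j, f (x j))}

lemma mem_leaveOneOut {n : ℕ} {f : X → I} {x : Fin n → X} {i : Fin n} {p : X × I} :
    p ∈ leaveOneOut f x i ↔ ∃ j, j ≠ i ∧ p = (x j, f (x j)) := Iff.rfl

/-- The prediction `h` for the `i`-th point of `x`, made from the other points, contradicts a
label `0` or `1` that `psi r γ ∘ f` gives it. -/
def Mistaken (h : Set (X × I) → X → Prop) (r : I) (γ : ℝ) (f : X → I) {n : ℕ}
    (x : Fin n → X) (i : Fin n) : Prop :=
  (psi r γ (f (x i)) = some true ∧ ¬ h (leaveOneOut f x i) (x i)) ∨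
    (psi r γ (f (x i)) = some false ∧ h (leaveOneOut f x i) (x i))

/-- A rule with at most `d` leave-one-out mistakes on every sample, at one threshold. -/
theorem exists_threshold_predictor (F : Set (X → I)) (r : I) (γ : ℝ) (d : ℕ)
    (hd : fatV F γ ≤ d) :
    ∃ h : Set (X × I) → X → Prop, ∀ f ∈ F, ∀ (n : ℕ) (x : Fin n → X) (J : Finset (Fin n)),
      (∀ i ∈ J, Mistaken h r γ f x i) → J.card ≤ d := by
  classical
  choose pred hpred using fun T : Finset X => exists_oneInclusion_predictor T d
    (totalConcepts F r γ T) (Finset.filter_subset _ _)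
    (fun S hS => card_le_of_totalConcepts_shatters hd hS)
  -- A point already seen with a decided label gets that label again; otherwise the one-inclusion
  -- rule is run on the decided points together with `x`.
  refine ⟨fun S x => x ∈ positivePoints r γ S ∨ (x ∉ decidedPoints r γ S ∧
    ∃ T A : Finset X, (T : Set X) = insert x (decidedPoints r γ S) ∧
      (A : Set X) = positivePoints r γ S ∧ pred T A x), fun f hf n x J hJ => ?_⟩
  set T : Finset X := (Finset.univ.image x).filter fun z => psi r γ (f z) ≠ none with hT
  set A : Finset X := T.filter fun z => psi r γ (f z) = some true with hA
  have hAV : A ∈ totalConcepts F r γ T := by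
    refine Finset.mem_filter.2 ⟨Finset.mem_powerset.2 (Finset.filter_subset _ _), f, hf, ?_⟩
    intro z hz
    have hz' := (Finset.mem_filter.1 hz).2
    rcases hpsi : psi r γ (f z) with _ | _ | _
    · exact absurd hpsi hz'
    · simp [hA, hpsi]
    · simp [hA, hpsi, hz]
  have key : ∀ i ∈ J, (∀ j, x j = x i → j = i) ∧ x i ∈ T ∧
      ¬ (pred T (A.erase (x i)) (x i) ↔ x i ∈ A) := by
    intro i hi
    have hmis := hJ i hi
    have hdec : psi r γ (f (x i)) ≠ none := by
      rcases hmis with h | h <;> simp [h.1]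
    have hTi : x i ∈ T := by simp [hT, hdec]
    -- A repeated decided point has its label in the sample, so mistakes occur only at points
    -- appearing once. Counting indices is then the same as counting points.
    have huniq : ∀ j, x j = x i → j = i := by
      intro j hj
      by_contra hne
      have hmem : (x i, f (x i)) ∈ leaveOneOut f x i := ⟨j, hne, by rw [hj]⟩
      rcases hmis with ⟨h₁, h₂⟩ | ⟨h₁, h₂⟩
      · exact h₂ (Or.inl ⟨_, hmem, h₁⟩)
      · rcases h₂ with ⟨y, ⟨k, -, hk⟩, hy⟩ | ⟨h₂, -⟩
        · simp only [Prod.mk.injEq] at hk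
          rw [hk.2, ← hk.1, h₁] at hy
          simp at hy
        · exact h₂ ⟨_, hmem, hdec⟩
    -- The domain `T` and the set `A.erase (x i)` can be recovered from the sample without its
    -- `i`-th point, so the rule evaluates `pred` exactly there.
    have hD : (T : Set X) = insert (x i) (decidedPoints r γ (leaveOneOut f x i)) := by
      ext z
      simp only [hT, Finset.coe_filter, Finset.mem_image, Finset.mem_univ, true_and,
        Set.mem_ofPred_eq, Set.mem_insert_iff, decidedPoints, mem_leaveOneOut, Prod.mk.injEq]
      constructor
      · rintro ⟨⟨j, rfl⟩, hj⟩
        by_cases h : j = i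
        · exact Or.inl (h ▸ rfl)
        · exact Or.inr ⟨_, ⟨j, h, rfl, rfl⟩, hj⟩
      · rintro (rfl | ⟨y, ⟨j, -, rfl, rfl⟩, hj⟩)
        · exact ⟨⟨i, rfl⟩, hdec⟩
        · exact ⟨⟨j, rfl⟩, hj⟩
    have hP : ((A.erase (x i) : Finset X) : Set X) =
        positivePoints r γ (leaveOneOut f x i) := by
      ext z
      simp only [hA, hT, Finset.coe_erase, Finset.coe_filter, Finset.mem_filter, Finset.mem_image,
        Finset.mem_univ, true_and, Set.mem_ofPred_eq, Set.mem_sdiff, Set.mem_singleton_iff,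
        positivePoints, mem_leaveOneOut, Prod.mk.injEq]
      constructor
      · rintro ⟨⟨⟨⟨j, rfl⟩, -⟩, hj⟩, hne⟩
        exact ⟨_, ⟨j, fun h => hne (h ▸ rfl), rfl, rfl⟩, hj⟩
      · rintro ⟨y, ⟨j, hne, rfl, rfl⟩, hj⟩
        exact ⟨⟨⟨⟨j, rfl⟩, by simp [hj]⟩, hj⟩, fun h => hne (huniq j h)⟩
    have hxP : x i ∉ positivePoints r γ (leaveOneOut f x i) := by
      rw [← hP]; simp
    have hxD : x i ∉ decidedPoints r γ (leaveOneOut f x i) := by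
      rintro ⟨y, ⟨j, hne, hj⟩, -⟩
      exact hne (huniq j (Prod.mk.injEq .. ▸ hj).1.symm)
    have hiff : (x i ∈ positivePoints r γ (leaveOneOut f x i) ∨
        (x i ∉ decidedPoints r γ (leaveOneOut f x i) ∧
        ∃ T A : Finset X, (T : Set X) = insert (x i) (decidedPoints r γ (leaveOneOut f x i)) ∧
        (A : Set X) = positivePoints r γ (leaveOneOut f x i) ∧ pred T A (x i))) ↔
        pred T (A.erase (x i)) (x i) := by
      constructor
      · rintro (h | ⟨-, T', A', hT', hA', h⟩)
        · exact absurd h hxP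
        · rw [← hD] at hT'
          rw [← hP] at hA'
          rwa [Finset.coe_injective hT', Finset.coe_injective hA'] at h
      · exact fun h => Or.inr ⟨hxD, T, _, hD, hP, h⟩
    refine ⟨huniq, hTi, ?_⟩
    unfold Mistaken at hmis
    simp only [hiff] at hmis
    rcases hmis with ⟨h₁, h₂⟩ | ⟨h₁, h₂⟩
    · exact fun h => h₂ (h.2 (Finset.mem_filter.2 ⟨hTi, h₁⟩))
    · exact fun h => by simpa [h₁] using (Finset.mem_filter.1 (h.1 h₂)).2
  have := hpred T A hAV (J.image x)
    (Finset.image_subset_iff.2 fun i hi => (key i hi).2.1)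
    (fun z hz => by
      obtain ⟨i, hi, rfl⟩ := Finset.mem_image.1 hz
      exact (key i hi).2.2)
  rwa [Finset.card_image_of_injOn fun i _ j hj hij => (key j hj).1 i hij] at this

end PartialConcepts

/-! ### Averaging over thresholds and over the order of the sample. -/

section Averaging

open MeasureTheory

/-- The grid point `k / n` of `[0,1]`. -/
noncomputable def gridPoint {n : ℕ} (k : Fin n) : I :=
  ⟨(k : ℝ) / n, by positivity, by
    have : (k : ℝ) ≤ n := by exact_mod_cast k.2.le
    exact div_le_one_of_le₀ this (by positivity)⟩

open Classical in
/-- The proportion of indices at which a predicate holds. -/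
noncomputable def proportion {n : ℕ} (h : Fin n → Prop) : I :=
  ⟨((Finset.univ.filter h).card : ℝ) / n, by positivity, by
    have : ((Finset.univ.filter h).card : ℝ) ≤ n := by
      exact_mod_cast (Finset.card_le_univ _).trans_eq (Fintype.card_fin n)
    exact div_le_one_of_le₀ this (by positivity)⟩

open Classical in
lemma card_filter_val_lt_le {n : ℕ} (z : ℝ) (hz : 0 ≤ z) :
    ((Finset.univ.filter fun k : Fin n => (k : ℝ) < z).card : ℝ) ≤ z + 1 := by
  have : (Finset.univ.filter fun k : Fin n => (k : ℝ) < z).card ≤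
      (Finset.range ⌈z⌉₊).card := by
    refine Finset.card_le_card_of_injOn Fin.val ?_ (Fin.val_injective.injOn)
    intro k hk
    simp only [Finset.coe_filter, Finset.mem_univ, true_and, Set.mem_ofPred_eq] at hk
    simpa using Nat.lt_ceil.2 hk
  rw [Finset.card_range] at this
  have h₁ : ((Finset.univ.filter fun k : Fin n => (k : ℝ) < z).card : ℝ) ≤ ⌈z⌉₊ := by
    exact_mod_cast this
  linarith [Nat.ceil_lt_add_one hz]

open Classical in
lemma le_card_filter_val_le {n : ℕ} (z : ℝ) (hz : z ≤ n) :
    z ≤ ((Finset.univ.filter fun k : Fin n => (k : ℝ) ≤ z).card : ℝ) := by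
  have : (Finset.range ⌈z⌉₊).card ≤
      ((Finset.univ.filter fun k : Fin n => (k : ℝ) ≤ z).image Fin.val).card := by
    refine Finset.card_le_card fun k hk => ?_
    have hkz : (k : ℝ) < z := Nat.lt_ceil.1 (Finset.mem_range.1 hk)
    have hkn : k < n := by exact_mod_cast hkz.trans_le hz
    exact Finset.mem_image.2 ⟨⟨k, hkn⟩, by simpa using hkz.le, rfl⟩
  rw [Finset.card_range] at this
  have h₁ := this.trans Finset.card_image_le
  exact (Nat.le_ceil z).trans (by exact_mod_cast h₁)

open Classical in
/-- Averaging threshold predictions over a grid recovers the value up to `γ`, the mesh, and the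
proportion of thresholds at which the prediction is mistaken. -/
lemma abs_proportion_sub_le {n : ℕ} (hn : 0 < n) {γ : ℝ} (hγ : 0 < γ) (y : I)
    (h : Fin n → Prop) :
    |(proportion h : ℝ) - y| ≤ γ + 1 / n + (Finset.univ.filter fun k : Fin n =>
      (psi (gridPoint k) γ y = some true ∧ ¬ h k) ∨
        (psi (gridPoint k) γ y = some false ∧ h k)).card / (n : ℝ) := by
  have hn' : (0 : ℝ) < n := by exact_mod_cast hn
  set M := Finset.univ.filter fun k : Fin n =>
      (psi (gridPoint k) γ y = some true ∧ ¬ h k) ∨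
        (psi (gridPoint k) γ y = some false ∧ h k) with hM
  have hup : ((Finset.univ.filter h).card : ℝ) ≤ n * (y + γ) + 1 + M.card := by
    -- A vote 1 at a threshold `k / n ≥ y + γ` contradicts the label 0 there, hence is a mistake;
    -- dually below for votes 0 at `k / n ≤ y - γ`.
    have hsub : Finset.univ.filter h ⊆
        (Finset.univ.filter fun k : Fin n => (k : ℝ) < n * (y + γ)) ∪ M := by
      intro k hk
      have hk' := (Finset.mem_filter.1 hk).2
      by_cases hlt : (k : ℝ) < n * (y + γ)
      · exact Finset.mem_union_left _ (by simpa using hlt)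
      · refine Finset.mem_union_right _ ?_
        rw [hM, Finset.mem_filter]
        refine ⟨Finset.mem_univ _, Or.inr ⟨(psi_eq_some_false_iff hγ).2 ?_, hk'⟩⟩
        have : (y : ℝ) + γ ≤ k / n := by
          rw [le_div_iff₀ hn']
          linarith
        simp only [gridPoint]
        linarith
    have h₁ : ((Finset.univ.filter h).card : ℝ) ≤
        (Finset.univ.filter fun k : Fin n => (k : ℝ) < n * (y + γ)).card + M.card := by
      exact_mod_cast (Finset.card_le_card hsub).trans (Finset.card_union_le _ _)
    have h₂ := card_filter_val_lt_le (n := n) (n * (y + γ))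
      (mul_nonneg hn'.le (add_nonneg y.2.1 hγ.le))
    linarith
  have hlow : n * ((y : ℝ) - γ) ≤ ((Finset.univ.filter h).card : ℝ) + M.card := by
    have hsub : (Finset.univ.filter fun k : Fin n => (k : ℝ) ≤ n * (y - γ)) ⊆
        Finset.univ.filter h ∪ M := by
      intro k hk
      have hk' := (Finset.mem_filter.1 hk).2
      by_cases hh : h k
      · exact Finset.mem_union_left _ (by simpa using hh)
      · refine Finset.mem_union_right _ ?_
        rw [hM, Finset.mem_filter]
        refine ⟨Finset.mem_univ _, Or.inl ⟨psi_eq_some_true_iff.2 ?_, hh⟩⟩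
        have : (k : ℝ) / n ≤ y - γ := by
          rw [div_le_iff₀ hn']
          linarith
        simp only [gridPoint]
        linarith
    have h₁ : ((Finset.univ.filter fun k : Fin n => (k : ℝ) ≤ n * (y - γ)).card : ℝ) ≤
        (Finset.univ.filter h).card + M.card := by
      exact_mod_cast (Finset.card_le_card hsub).trans (Finset.card_union_le _ _)
    have h₂ := le_card_filter_val_le (n := n) (n * (y - γ)) (by
      have := y.2.2
      nlinarith)
    exact h₂.trans h₁
  have hp : (proportion h : ℝ) = ((Finset.univ.filter h).card : ℝ) / n := rfl
  rw [hp, abs_le]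
  constructor
  · rw [← sub_nonneg]
    have : ((Finset.univ.filter h).card : ℝ) / n - y - -(γ + 1 / n + M.card / n) =
        ((Finset.univ.filter h).card + M.card - n * (y - γ) + 1) / n := by
      field_simp
      ring
    rw [this]
    exact div_nonneg (by linarith) hn'.le
  · rw [← sub_nonneg]
    have : γ + 1 / n + M.card / n - (((Finset.univ.filter h).card : ℝ) / n - y) =
        (n * (y + γ) + 1 + M.card - (Finset.univ.filter h).card) / n := by
      field_simp
      ring
    rw [this]
    exact div_nonneg (by linarith) hn'.le

lemma leaveOneOut_comp_perm {X : Type*} {n : ℕ} (f : X → I) (x : Fin n → X)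
    (τ : Equiv.Perm (Fin n)) (i : Fin n) :
    leaveOneOut f (x ∘ τ) i = leaveOneOut f x (τ i) := by
  ext p
  simp only [mem_leaveOneOut, Function.comp_apply]
  constructor
  · rintro ⟨j, hj, hp⟩
    exact ⟨τ j, fun h => hj (τ.injective h), hp⟩
  · rintro ⟨j, hj, hp⟩
    exact ⟨τ.symm j, fun h => hj (by simp [← h]), by simpa using hp⟩

/-- A property of one point relative to the others, which never holds for more than `d` of the
points, has probability at most `d / n` for `n` independent points. -/
lemma measure_le_of_exchangeable {X : Type*} [Countable X] [MeasurableSpace X]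
    [DiscreteMeasurableSpace X] (D : Measure X) [IsProbabilityMeasure D] {n d : ℕ}
    (P : (Fin n → X) → Fin n → Prop)
    (hP : ∀ x (τ : Equiv.Perm (Fin n)) i, P (x ∘ τ) i ↔ P x (τ i))
    (hd : ∀ x (J : Finset (Fin n)), (∀ i ∈ J, P x i) → J.card ≤ d) (i : Fin n) :
    n * (Measure.pi fun _ : Fin n => D) {x | P x i} ≤ d := by
  classical
  have hmeas : ∀ s : Set (Fin n → X), MeasurableSet s := fun s => s.to_countable.measurableSet
  -- Swapping two coordinates preserves the product measure, so all `n` events are equally likely;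
  -- their indicators sum to at most `d` pointwise.
  have heq : ∀ j, (Measure.pi fun _ : Fin n => D) {x | P x j} =
      (Measure.pi fun _ : Fin n => D) {x | P x i} := by
    intro j
    have hpres := measurePreserving_arrowCongr' (fun _ => D) (fun _ => D)
      (Equiv.swap i j) (MeasurableEquiv.refl X) (fun _ => MeasurePreserving.id D)
    rw [← hpres.measure_preimage (hmeas {x | P x i}).nullMeasurableSet]
    congr 1
    ext x
    have := hP x (Equiv.swap i j) i
    rw [Equiv.swap_apply_left] at this
    exact this.symm
  have hsum : ∑ j, (Measure.pi fun _ : Fin n => D) {x | P x j} ≤ d := by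
    have : ∀ j, (Measure.pi fun _ : Fin n => D) {x | P x j} =
        ∫⁻ x, ({x | P x j}.indicator 1 x) ∂(Measure.pi fun _ : Fin n => D) :=
      fun j => (lintegral_indicator_one (hmeas _)).symm
    simp_rw [this]
    rw [← lintegral_finsetSum _ fun j _ => measurable_one.indicator (hmeas _)]
    refine (lintegral_mono (g := fun _ => (d : ℝ≥0∞)) fun x => ?_).trans_eq (by simp)
    simp only [Set.indicator_apply, Set.mem_ofPred_eq, Pi.one_apply, Finset.sum_boole]
    exact_mod_cast hd x _ fun j hj => (Finset.mem_filter.1 hj).2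
  simpa [heq] using hsum

/-- The prediction error is at most `γ + 1 / n + d / m`, for every grid size `n`. -/
theorem minimaxError_le {X : Type*} [Countable X] [MeasurableSpace X] [DiscreteMeasurableSpace X]
    (F : Set (X → I)) {γ : ℝ} (hγ : 0 < γ) {d : ℕ} (hd : fatV F γ ≤ d) {n : ℕ} (hn : 0 < n)
    (m : ℕ+) :
    minimaxError F m ≤ ENNReal.ofReal (γ + 1 / n + d / (m : ℕ)) := by
  classical
  have hn' : (0 : ℝ) < n := by exact_mod_cast hn
  choose h hh using fun k : Fin n => exists_threshold_predictor F (gridPoint k) γ d hd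
  refine (iInf_le _ fun p => proportion fun k => h k {q | q ∈ p.1} p.2).trans ?_
  refine iSup_le fun D => iSup₂_le fun f hf => ?_
  set N := m.natPred with hN
  have hm : (m : ℕ) = N + 1 := (PNat.natPred_add_one m).symm
  set μ : Measure (Fin (N + 1) → X) := Measure.pi fun _ => (D : Measure X) with hμ
  have hmeas : ∀ s : Set (Fin (N + 1) → X), MeasurableSet s :=
    fun s => s.to_countable.measurableSet
  let B : Fin n → Set (Fin (N + 1) → X) :=
    fun k => {x | Mistaken (h k) (gridPoint k) γ f x (Fin.last N)}
  have hB : ∀ k, μ (B k) ≤ ENNReal.ofReal (d / (m : ℕ)) := by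
    intro k
    have := measure_le_of_exchangeable (D : Measure X) (d := d)
      (fun x i => Mistaken (h k) (gridPoint k) γ f x i)
      (fun x τ i => by simp only [Mistaken, leaveOneOut_comp_perm, Function.comp_apply])
      (fun x J hJ => hh k f hf _ x J hJ) (Fin.last N)
    rw [ENNReal.ofReal_div_of_pos (by exact_mod_cast m.pos), ENNReal.ofReal_natCast,
      ENNReal.ofReal_natCast, hm, ENNReal.le_div_iff_mul_le (by simp) (by simp), mul_comm]
    exact this
  have hpt : ∀ x : Fin (N + 1) → X,
      ENNReal.ofReal |((proportion fun k => h k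
        {q | q ∈ List.ofFn fun i : Fin N => (x i.castSucc, f (x i.castSucc))}
          (x (Fin.last N)) : I) : ℝ) - f (x (Fin.last N))| ≤
      ENNReal.ofReal (γ + 1 / n) +
        ∑ k, ENNReal.ofReal (1 / n) * (B k).indicator 1 x := by
    intro x
    have hlist : {q | q ∈ List.ofFn fun i : Fin N => (x i.castSucc, f (x i.castSucc))} =
        leaveOneOut f x (Fin.last N) := by
      ext q
      simp only [Set.mem_ofPred_eq, List.mem_ofFn, mem_leaveOneOut]
      constructor
      · rintro ⟨i, rfl⟩
        exact ⟨i.castSucc, (Fin.castSucc_lt_last i).ne, rfl⟩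
      · rintro ⟨j, hj, rfl⟩
        exact ⟨j.castPred hj, by simp⟩
    rw [hlist, ← Finset.mul_sum]
    refine (ENNReal.ofReal_le_ofReal (abs_proportion_sub_le hn hγ _ _)).trans ?_
    rw [ENNReal.ofReal_add (by positivity) (by positivity)]
    gcongr
    rw [div_eq_mul_one_div, mul_comm, ENNReal.ofReal_mul (by positivity), ENNReal.ofReal_natCast]
    gcongr
    simp only [Set.indicator_apply, Pi.one_apply, Finset.sum_boole]
    refine le_of_eq ?_
    congr!
  refine (lintegral_mono hpt).trans ?_
  rw [lintegral_add_left measurable_const, lintegral_finsetSum _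
    fun k _ => (measurable_one.indicator (hmeas _)).const_mul _]
  simp_rw [lintegral_const_mul _ (measurable_one.indicator (hmeas _)),
    lintegral_indicator_one (hmeas _)]
  rw [ENNReal.ofReal_add (p := γ + 1 / n) (by positivity) (by positivity), lintegral_const,
    measure_univ, mul_one]
  gcongr
  calc ∑ k, ENNReal.ofReal (1 / n) * μ (B k)
        ≤ ∑ _k : Fin n, ENNReal.ofReal (1 / n) * ENNReal.ofReal (d / (m : ℕ)) := by
          gcongr with k
          exact hB k
      _ = ENNReal.ofReal (d / (m : ℕ)) := by
          rw [Finset.sum_const, Finset.card_univ, Fintype.card_fin, nsmul_eq_mul, ← mul_assoc,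
            ← ENNReal.ofReal_natCast n, ← ENNReal.ofReal_mul hn'.le, mul_one_div_cancel hn'.ne',
            ENNReal.ofReal_one, one_mul]

theorem eventually_minimaxError_lt {X : Type*} [Countable X] [MeasurableSpace X]
    [DiscreteMeasurableSpace X] (F : Set (X → I)) {ε α : ℝ} (hα : 0 < α) (hαε : α < ε)
    (hfin : fatV F (ε - α) < ⊤) :
    ∃ M : ℕ+, ∀ m : ℕ+, M ≤ m → minimaxError F m < ENNReal.ofReal ε := by
  obtain ⟨d, hd⟩ := ENat.ne_top_iff_exists.1 hfin.ne
  -- The slack `α` is split so that `1 / n` and `d / m` each stay below `α / 3`.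
  obtain ⟨n, hn⟩ := exists_nat_gt (3 / α)
  obtain ⟨K, hK⟩ := exists_nat_gt (3 * d / α)
  have hn' : (0 : ℝ) < n := (by positivity : (0 : ℝ) < 3 / α).trans hn
  have hnpos : 0 < n := by exact_mod_cast hn'
  refine ⟨⟨K + 1, K.succ_pos⟩, fun m hm => ?_⟩
  refine (minimaxError_le F (sub_pos.2 hαε) hd.ge hnpos m).trans_lt ?_
  rw [ENNReal.ofReal_lt_ofReal_iff (hα.trans hαε)]
  have hmK : (K : ℝ) ≤ (m : ℕ) := by
    have : K + 1 ≤ (m : ℕ) := hm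
    exact_mod_cast (Nat.le_succ K).trans this
  have hm' : (0 : ℝ) < (m : ℕ) := by exact_mod_cast m.pos
  have h₁ : (1 : ℝ) / n < α / 3 := by
    rw [div_lt_iff₀ hα] at hn
    rw [div_lt_div_iff₀ hn' (by norm_num)]
    linarith
  have h₂ : (d : ℝ) / (m : ℕ) < α / 3 := by
    have := hK.trans_le hmK
    rw [div_lt_iff₀ hα] at this
    rw [div_lt_div_iff₀ hm' (by norm_num)]
    linarith
  linarith

end Averaging

/-! ### Two-valued functions and the lower bound. -/

section LowerBound

open MeasureTheory

/-- The functions whose values all lie in `{1/2 - ε, 1/2 + ε}`. -/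
def twoValued (ε : ℝ) : Set (ℕ → I) :=
  {f | ∀ x, (f x : ℝ) = 1 / 2 - ε ∨ (f x : ℝ) = 1 / 2 + ε}

/-- The function with values `1/2 + ε` and `1/2 - ε` prescribed by a bit pattern. -/
noncomputable def twoValuedOf {ε : ℝ} (h₀ : 0 < ε) (h₁ : ε ≤ 1 / 2) (b : ℕ → Bool) : ℕ → I :=
  fun x => ⟨if b x then 1 / 2 + ε else 1 / 2 - ε, by split_ifs <;> constructor <;> linarith⟩

lemma twoValuedOf_mem {ε : ℝ} (h₀ : 0 < ε) (h₁ : ε ≤ 1 / 2) (b : ℕ → Bool) :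
    twoValuedOf h₀ h₁ b ∈ twoValued ε := by
  intro x
  by_cases h : b x <;> simp [twoValuedOf, h]

lemma fatV_twoValued_eq_top {ε : ℝ} (h₀ : 0 < ε) (h₁ : ε ≤ 1 / 2) :
    fatV (twoValued ε) ε = ⊤ := by
  rw [ENat.eq_top_iff_forall_ge]
  intro d
  have hsh : FatlyVShattered (twoValued ε) ε (fun i : Fin d => (i : ℕ)) := by
    refine ⟨⟨1 / 2, by norm_num, by norm_num⟩, fun b => ?_⟩
    refine ⟨_, twoValuedOf_mem h₀ h₁ fun k => if h : k < d then b ⟨k, h⟩ else false, fun i => ?_⟩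
    rcases hb : b i
    · rw [psi_eq_some_false_iff h₀]
      simp [twoValuedOf, hb]
    · rw [psi_eq_some_true_iff]
      simp [twoValuedOf, hb]
  exact le_iSup₂ (f := fun (d : ℕ) (_ : d ∈ {d : ℕ | ∃ x : Fin d → ℕ,
    FatlyVShattered (twoValued ε) ε x}) => (d : ℕ∞)) d ⟨_, hsh⟩

/-- Shattering even one point needs two values at distance at least `2 * (ε + α)`, but the values
available differ by at most `2 * ε`. -/
lemma fatV_twoValued_eq_zero {ε α : ℝ} (h₀ : 0 < ε) (hα : 0 < α) :
    fatV (twoValued ε) (ε + α) = 0 := by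
  rw [fatV, ← nonpos_iff_eq_zero]
  refine iSup₂_le fun d hd => ?_
  obtain ⟨x, r, h⟩ := hd
  rcases Nat.eq_zero_or_pos d with rfl | hpos
  · simp
  · exfalso
    obtain ⟨f, hf, hfx⟩ := h fun _ => true
    obtain ⟨g, hg, hgx⟩ := h fun _ => false
    have h₁ := psi_eq_some_true_iff.1 (hfx ⟨0, hpos⟩)
    have h₂ := (psi_eq_some_false_iff (by linarith)).1 (hgx ⟨0, hpos⟩)
    rcases hf (x ⟨0, hpos⟩) with h₃ | h₃ <;> rcases hg (x ⟨0, hpos⟩) with h₄ | h₄ <;> linarith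

/-- The uniform distribution on `{0, …, N}`. -/
noncomputable def uniformUpTo (N : ℕ) : ProbabilityMeasure ℕ :=
  ⟨(PMF.uniformOfFinset (Finset.range (N + 1)) Finset.nonempty_range_add_one).toMeasure,
    inferInstance⟩

lemma uniformUpTo_singleton_le (N k : ℕ) :
    (uniformUpTo N : Measure ℕ) {k} ≤ ((N : ℝ≥0∞) + 1)⁻¹ := by
  change (PMF.uniformOfFinset (Finset.range (N + 1)) _).toMeasure {k} ≤ _
  rw [PMF.toMeasure_apply_singleton _ _ (measurableSet_singleton k), PMF.uniformOfFinset_apply]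
  split_ifs <;> simp

/-- The coincidence probability is at most the sum of the squared point masses, hence at most the
largest mass. -/
lemma measure_coincidence_le (N n : ℕ) {i j : Fin n} (hij : i ≠ j) :
    (Measure.pi fun _ : Fin n => (uniformUpTo N : Measure ℕ)) {x | x i = x j} ≤
      ((N : ℝ≥0∞) + 1)⁻¹ := by
  classical
  set D : Measure ℕ := (uniformUpTo N : Measure ℕ) with hD
  have hsub : {x : Fin n → ℕ | x i = x j} ⊆
      ⋃ k : ℕ, Set.univ.pi fun l => if l = i ∨ l = j then {k} else Set.univ := by
    intro x hx
    refine Set.mem_iUnion.2 ⟨x i, fun l _ => ?_⟩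
    have hx' : x i = x j := hx
    by_cases h : l = i ∨ l = j
    · rcases h with rfl | rfl <;> simp [hx']
    · simp [h]
  have hbox : ∀ k : ℕ, (Measure.pi fun _ : Fin n => D)
      (Set.univ.pi fun l => if l = i ∨ l = j then {k} else Set.univ) = D {k} * D {k} := by
    intro k
    rw [Measure.pi_pi, ← Finset.prod_subset (Finset.subset_univ {i, j})]
    · rw [Finset.prod_pair hij]; simp
    · intro l _ hl
      simp only [Finset.mem_insert, Finset.mem_singleton] at hl
      simp [hl]
  calc (Measure.pi fun _ : Fin n => D) {x | x i = x j}
      ≤ ∑' k, (Measure.pi fun _ : Fin n => D)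
          (Set.univ.pi fun l => if l = i ∨ l = j then {k} else Set.univ) :=
        (measure_mono hsub).trans (measure_iUnion_le _)
    _ = ∑' k, D {k} * D {k} := by simp_rw [hbox]
    _ ≤ ∑' k, D {k} * ((N : ℝ≥0∞) + 1)⁻¹ :=
        ENNReal.tsum_le_tsum fun k => mul_le_mul_right (uniformUpTo_singleton_le N k) _
    _ = ((N : ℝ≥0∞) + 1)⁻¹ := by
        rw [ENNReal.tsum_mul_right]
        have : ∑' k, D {k} = D Set.univ := by
          rw [← Measure.tsum_indicator_apply_singleton D _ MeasurableSet.univ]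
          simp
        rw [this, measure_univ, one_mul]

/-- Some two-valued target on `{0, …, N}` defeats a given strategy whenever the test point is new.
-/
lemma le_iSup_expectedError {ε : ℝ} (h₀ : 0 < ε) (h₁ : ε ≤ 1 / 2) (A : PredictionStrategy ℕ)
    (m : ℕ+) (N : ℕ) :
    ENNReal.ofReal ε * (1 - m.natPred * ((N : ℝ≥0∞) + 1)⁻¹) ≤
      ⨆ f ∈ twoValued ε, expectedError A (uniformUpTo N) f m := by
  classical
  set n := m.natPred with hn
  set μ : Measure (Fin (n + 1) → ℕ) :=
    Measure.pi fun _ => (uniformUpTo N : Measure ℕ) with hμ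
  have hmeas : ∀ s : Set (Fin (n + 1) → ℕ), MeasurableSet s :=
    fun s => s.to_countable.measurableSet
  have hmeasf : ∀ g : (Fin (n + 1) → ℕ) → ℝ≥0∞, Measurable g := fun g s _ => hmeas _
  let F : Finset (Fin (N + 1)) → ℕ → I := fun s =>
    twoValuedOf h₀ h₁ fun k => decide (∃ h : k < N + 1, (⟨k, h⟩ : Fin (N + 1)) ∈ s)
  let err : Finset (Fin (N + 1)) → (Fin (n + 1) → ℕ) → ℝ≥0∞ := fun s x =>
    ENNReal.ofReal |(A (List.ofFn fun i : Fin n => (x i.castSucc, F s (x i.castSucc)),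
      x (Fin.last n)) : ℝ) - F s (x (Fin.last n))|
  -- The good samples: the test point lies in the range labelled by `s` and differs from all
  -- training points.
  let G : Set (Fin (n + 1) → ℕ) := {x | x (Fin.last n) < N + 1 ∧
    ∀ i : Fin n, x i.castSucc ≠ x (Fin.last n)}
  have hpair : ∀ x ∈ G, ENNReal.ofReal ε * (2 ^ (N + 1) : ℕ) ≤ ∑ s, err s x := by
    rintro x ⟨hxN, hx⟩
    set t : Finset (Fin (N + 1)) := {⟨x (Fin.last n), hxN⟩} with ht
    -- Toggling the test point in `s` keeps the training list and moves the target value by `2 * ε`,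
    -- so by the triangle inequality the two errors add up to at least `2 * ε`.
    have hflip : ∀ s, ENNReal.ofReal (2 * ε) ≤ err s x + err (symmDiff s t) x := by
      intro s
      have hlist : (List.ofFn fun i : Fin n => (x i.castSucc, F (symmDiff s t) (x i.castSucc))) =
          List.ofFn fun i : Fin n => (x i.castSucc, F s (x i.castSucc)) := by
        congr 1
        funext i
        simp only [F, twoValuedOf, Finset.mem_symmDiff, ht, Finset.mem_singleton, Fin.mk.injEq,
          hx i, not_false_eq_true, and_true, false_and, or_false]
      simp only [err, hlist]
      rw [← ENNReal.ofReal_add (abs_nonneg _) (abs_nonneg _)]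
      refine ENNReal.ofReal_le_ofReal ?_
      set a : ℝ := (A (List.ofFn fun i : Fin n => (x i.castSucc, F s (x i.castSucc)),
        x (Fin.last n)) : ℝ)
      have hval : |(F s (x (Fin.last n)) : ℝ) - F (symmDiff s t) (x (Fin.last n))| = 2 * ε := by
        by_cases hs : (⟨x (Fin.last n), hxN⟩ : Fin (N + 1)) ∈ s
        · simp only [F, twoValuedOf, Finset.mem_symmDiff, ht, Finset.mem_singleton, hs, hxN]
          norm_num
          rw [abs_of_pos (by linarith)]; ring
        · simp only [F, twoValuedOf, Finset.mem_symmDiff, ht, Finset.mem_singleton, hs, hxN]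
          norm_num
          rw [abs_of_neg (by linarith)]; ring
      rw [← hval]
      have := abs_sub_le (F s (x (Fin.last n)) : ℝ) a (F (symmDiff s t) (x (Fin.last n)))
      rwa [abs_sub_comm _ a] at this
    -- Toggling is an involution on the subsets, so pairing each `s` with its partner gives an
    -- average error of at least `ε`.
    have hinv : ∑ s, err (symmDiff s t) x = ∑ s, err s x :=
      Equiv.sum_comp (Function.Involutive.toPerm (fun s => symmDiff s t)
        (fun s => symmDiff_symmDiff_cancel_right t s)) fun s => err s x
    have hsum : ∑ _s : Finset (Fin (N + 1)), ENNReal.ofReal (2 * ε) ≤ 2 * ∑ s, err s x := by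
      rw [two_mul (∑ s, err s x)]
      nth_rewrite 2 [← hinv]
      rw [← Finset.sum_add_distrib]
      exact Finset.sum_le_sum fun s _ => hflip s
    rw [Finset.sum_const, Finset.card_univ, Fintype.card_finset, Fintype.card_fin, nsmul_eq_mul,
      ENNReal.ofReal_mul (by norm_num), ENNReal.ofReal_ofNat, mul_left_comm] at hsum
    rw [mul_comm]
    exact (ENNReal.mul_le_mul_iff_right (by norm_num) (by norm_num)).1 hsum
  have hG : 1 - n * ((N : ℝ≥0∞) + 1)⁻¹ ≤ μ G := by
    have hout : μ {x | ¬ x (Fin.last n) < N + 1} = 0 := by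
      have hpres := measurePreserving_eval (fun _ : Fin (n + 1) => (uniformUpTo N : Measure ℕ))
        (Fin.last n)
      have h := hpres.measure_preimage (s := {k | ¬ k < N + 1})
        (DiscreteMeasurableSpace.forall_measurableSet _).nullMeasurableSet
      refine h.trans ?_
      change (PMF.uniformOfFinset (Finset.range (N + 1)) _).toMeasure _ = 0
      rw [PMF.toMeasure_apply_eq_zero_iff _ (DiscreteMeasurableSpace.forall_measurableSet _),
        PMF.support_uniformOfFinset, Set.disjoint_left]
      intro k hk
      simpa using hk
    have hcompl : μ Gᶜ ≤ n * ((N : ℝ≥0∞) + 1)⁻¹ := by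
      have hsub : Gᶜ ⊆ {x | ¬ x (Fin.last n) < N + 1} ∪
          ⋃ i : Fin n, {x | x i.castSucc = x (Fin.last n)} := by
        intro x hx
        by_contra hcon
        simp only [Set.mem_union, Set.mem_iUnion, Set.mem_ofPred_eq, not_or, not_exists,
          not_not] at hcon
        exact hx hcon
      calc μ Gᶜ ≤ μ {x | ¬ x (Fin.last n) < N + 1} +
            ∑ i : Fin n, μ {x | x i.castSucc = x (Fin.last n)} :=
            (measure_mono hsub).trans ((measure_union_le _ _).trans
              (add_le_add le_rfl (measure_iUnion_fintype_le _ _)))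
        _ ≤ 0 + ∑ _i : Fin n, ((N : ℝ≥0∞) + 1)⁻¹ :=
            add_le_add hout.le (Finset.sum_le_sum fun i _ =>
              measure_coincidence_le N (n + 1) (Fin.castSucc_lt_last i).ne)
        _ = n * ((N : ℝ≥0∞) + 1)⁻¹ := by simp
    rw [← compl_compl G, prob_compl_eq_one_sub (hmeas _)]
    exact tsub_le_tsub_left hcompl 1
  have havg : ENNReal.ofReal ε * (2 ^ (N + 1) : ℕ) * μ G ≤ ∑ s, ∫⁻ x, err s x ∂μ := by
    rw [← lintegral_finsetSum _ fun s _ => hmeasf _, ← lintegral_indicator_const (hmeas G)]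
    refine lintegral_mono fun x => ?_
    by_cases hx : x ∈ G
    · simpa [hx] using hpair x hx
    · simp [hx]
  have hle : ∑ s, ∫⁻ x, err s x ∂μ ≤
      (2 ^ (N + 1) : ℕ) * ⨆ f ∈ twoValued ε, expectedError A (uniformUpTo N) f m := by
    refine (Finset.sum_le_sum fun s _ => le_iSup₂ (f := fun f (_ : f ∈ twoValued ε) =>
      expectedError A (uniformUpTo N) f m) (F s) (twoValuedOf_mem h₀ h₁ _)).trans_eq ?_
    rw [Finset.sum_const, Finset.card_univ, Fintype.card_finset, Fintype.card_fin, nsmul_eq_mul]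
  refine (mul_le_mul_right hG _).trans ?_
  have := havg.trans hle
  rw [mul_comm (ENNReal.ofReal ε), mul_assoc] at this
  exact (ENNReal.mul_le_mul_iff_right (by norm_num) (by norm_num)).1 this

/-- For fixed `A` and `m`, the supremum over `D` admits every `N`, and the coincidence loss vanishes
as `N` grows, leaving exactly `ε`. -/
theorem le_minimaxError_twoValued {ε : ℝ} (h₀ : 0 < ε) (h₁ : ε ≤ 1 / 2) (m : ℕ+) :
    ENNReal.ofReal ε ≤ minimaxError (twoValued ε) m := by
  refine le_iInf fun A => ?_
  have hlim : Filter.Tendsto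
      (fun N : ℕ => ENNReal.ofReal ε * (1 - m.natPred * ((N : ℝ≥0∞) + 1)⁻¹)) Filter.atTop
      (nhds (ENNReal.ofReal ε * (1 - m.natPred * 0))) := by
    have hinv : Filter.Tendsto (fun N : ℕ => ((N : ℝ≥0∞) + 1)⁻¹) Filter.atTop (nhds 0) := by
      have := (Filter.tendsto_add_atTop_iff_nat 1).2 ENNReal.tendsto_inv_nat_nhds_zero
      simpa using this
    refine ENNReal.Tendsto.const_mul (ENNReal.Tendsto.sub tendsto_const_nhds
      (ENNReal.Tendsto.const_mul hinv (Or.inr (by simp))) (by simp)) (Or.inr (by simp))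
  rw [mul_zero, tsub_zero, mul_one] at hlim
  exact le_of_tendsto' hlim fun N => (le_iSup_expectedError h₀ h₁ A m N).trans
    (le_iSup (fun D => ⨆ f ∈ twoValued ε, expectedError A D f m) (uniformUpTo N))

end LowerBound

theorem mainTheorem3 (ε : ℝ) (hε : 0 < ε) :
    (∀ (X : Type*) [Countable X] [MeasurableSpace X] [DiscreteMeasurableSpace X]
        (F : Set (X → I)),
      (∃ α : ℝ, 0 < α ∧ α < ε ∧ fatV F (ε - α) < ⊤) →
        ∃ M : ℕ+, ∀ m : ℕ+, M ≤ m → minimaxError F m < ENNReal.ofReal ε) ∧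
    (ε ≤ 1 / 2 →
      ∃ F : Set (ℕ → I),
        fatV F ε = ⊤ ∧
        (∀ α : ℝ, 0 < α → fatV F (ε + α) = 0) ∧
        ∀ m : ℕ+, ENNReal.ofReal ε ≤ minimaxError F m) := by
  refine ⟨fun X _ _ _ F => ?_, fun h => ?_⟩
  · rintro ⟨α, hα, hαε, hfin⟩
    exact eventually_minimaxError_lt F hα hαε hfin
  · exact ⟨twoValued ε, fatV_twoValued_eq_top hε h, fun α hα => fatV_twoValued_eq_zero hε hα,
      le_minimaxError_twoValued hε h⟩
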